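/- \textbf{Theorem.} A topological space is \emph{almost discrete} if it has precisely one nonisolated point. For a Tychonoff space $X$, let $C_p(X)$ be the space of all continuous functions $X\to\mathbb{R}$ with the topology of pointwise convergence. A subset $A$ of a space $Y$ is \emph{countably compact in $Y$} if every infinite subset of $A$ has a limit (accumulation) point in $Y$; $Y$ is a \emph{$g$-space} if the closure in $Y$ of every set $A\subseteq Y$ that is countably compact in $Y$ is compact, and a \emph{hereditary $g$-space} if every subspace of $Y$ is a $g$-space. A Tychonoff space $X$ is a \emph{Grothendieck space} if $C_p(X)$ is a hereditary $g$-space. Let $I$ be a countable index set (finite, or infinite as for $I=\mathbb{N}$), and let $X_i$ $(i\in I)$ be almost discrete Grothendieck spaces. Then the free topological sum (disjoint union) $X=\bigoplus\{X_i : i\in I\}$ is a Grothendieck space. -/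

import Mathlib

open Topology Filter

/-- A topological space is almost discrete if it has precisely one nonisolated point. -/
def IsAlmostDiscrete (X : Type*) [TopologicalSpace X] : Prop :=
  ∃! x : X, ¬ IsOpen ({x} : Set X)

/-- The space `C_p(X)` of continuous real-valued functions on `X` with the topology of pointwise
convergence: the topology is the subspace topology inherited from the product `X → ℝ`. -/
abbrev Cp (X : Type*) [TopologicalSpace X] : Type _ :=
  {f : X → ℝ // Continuous f}

/-- `A` is countably compact in `Y`: every infinite subset of `A` has a limit point in `Y`. -/
def IsCountablyCompactIn {Y : Type*} [TopologicalSpace Y] (A : Set Y) : Prop :=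
  ∀ B : Set Y, B ⊆ A → B.Infinite → ∃ y : Y, AccPt y (𝓟 B)

/-- `Y` is a g-space: every subset of `Y` that is countably compact in `Y` has compact closure. -/
def IsGSpace (Y : Type*) [TopologicalSpace Y] : Prop :=
  ∀ A : Set Y, IsCountablyCompactIn A → IsCompact (closure A)

/-- `Y` is a hereditary g-space: every subspace of `Y` is a g-space. -/
def IsHereditaryGSpace (Y : Type*) [TopologicalSpace Y] : Prop :=
  ∀ S : Set Y, IsGSpace S

/-- A Grothendieck space is a Tychonoff space `X` such that `C_p(X)` is a hereditary g-space. -/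
def IsGrothendieckSpace (X : Type*) [TopologicalSpace X] : Prop :=
  T35Space X ∧ IsHereditaryGSpace (Cp X)

open Set

/-! ### Countably compact subsets and Fréchet–Urysohn arguments -/

/-! The g-space property passes to `C_p` of a sum because a function on the sum is a family of
functions on the summands, so Tychonoff's theorem applies (`isGSpace_Cp_sigma`). Heredity comes from
the Fréchet–Urysohn property (`IsHereditaryGSpace.of_frechetUrysohn`). Each function on a summand
equals its value at the nonisolated point off a countable set (`countable_setOf_apply_ne`). As there
are countably many summands, a function on the sum is governed, up to a countable set, by its values
at countably many points, and `frechetUrysohnSpace_Cp` applies. -/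

theorem IsCountablyCompactIn.image {Y Z : Type*} [TopologicalSpace Y] [T1Space Y]
    [TopologicalSpace Z] {A : Set Y} (hA : IsCountablyCompactIn A) {f : Y → Z}
    (hf : Continuous f) : IsCountablyCompactIn (f '' A) := by
  intro B hBA hB
  obtain ⟨B', hB'A, hbij⟩ := SurjOn.exists_bijOn_subset (f := f) (s := A) (t := B) hBA
  have hB' : B'.Infinite := fun h => hB (hbij.image_eq ▸ h.image f)
  obtain ⟨y, hy⟩ := hA B' hB'A hB'
  refine ⟨f y, ?_⟩
  rw [accPt_iff_nhds] at hy ⊢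
  intro U hU
  have hU' : f ⁻¹' U ∈ 𝓝 y := hf.continuousAt hU
  -- By injectivity on `B'`, at most one such `z₀` exists; deleting it from the neighbourhood
  -- prevents the point found from mapping to `f y`.
  by_cases hex : ∃ z₀ ∈ B', f z₀ = f y ∧ z₀ ≠ y
  · obtain ⟨z₀, hz₀, hfz, hne⟩ := hex
    obtain ⟨z, ⟨⟨hzU, hzz⟩, hzB⟩, -⟩ :=
      hy _ (inter_mem hU' (isOpen_compl_singleton.mem_nhds (Ne.symm hne)))
    exact ⟨f z, ⟨hzU, hbij.mapsTo hzB⟩,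
      fun h => hzz (hbij.injOn hzB hz₀ (h.trans hfz.symm))⟩
  · obtain ⟨z, ⟨hzU, hzB⟩, hzy⟩ := hy _ hU'
    exact ⟨f z, ⟨hzU, hbij.mapsTo hzB⟩, fun h => hex ⟨z, hzB, h, hzy⟩⟩

theorem AccPt.eq_of_tendsto {Y : Type*} [TopologicalSpace Y] [T2Space Y] {a : ℕ → Y} {x y : Y}
    (hy : AccPt y (𝓟 (range a))) (ha : Tendsto a atTop (𝓝 x)) : y = x := by
  by_contra hne
  obtain ⟨U, V, hU, hV, hyU, hxV, hUV⟩ := t2_separation hne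
  obtain ⟨m, hm⟩ := eventually_atTop.1 (ha (hV.mem_nhds hxV))
  have hfin : ((a '' Iio m) \ {y}).Finite := ((finite_Iio m).image a).subset sdiff_subset
  rw [accPt_iff_nhds] at hy
  obtain ⟨z, ⟨⟨hzU, hzt⟩, ⟨n, rfl⟩⟩, hzy⟩ := hy _ (inter_mem (hU.mem_nhds hyU)
    (hfin.isClosed.isOpen_compl.mem_nhds (fun h => h.2 rfl)))
  rcases lt_or_ge n m with h | h
  · exact hzt ⟨⟨n, h, rfl⟩, hzy⟩
  · exact disjoint_left.1 hUV hzU (hm n h)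

/-- A Hausdorff Fréchet–Urysohn g-space is a hereditary g-space. -/
theorem IsHereditaryGSpace.of_frechetUrysohn {Y : Type*} [TopologicalSpace Y] [T2Space Y]
    [FrechetUrysohnSpace Y] (hY : IsGSpace Y) : IsHereditaryGSpace Y := by
  intro S A hA
  have hK : IsCompact (closure (Subtype.val '' A)) := hY _ (hA.image continuous_subtype_val)
  -- A sequence in `A` with infinite range accumulates in `S`, and its limit is its only possible
  -- accumulation point.
  have hsub : closure (Subtype.val '' A) ⊆ S := by
    intro x hx
    obtain ⟨a, haA, hax⟩ := mem_closure_iff_seq_limit.1 hx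
    have haS : ∀ n, a n ∈ S := fun n => by
      obtain ⟨z, -, hz⟩ := haA n
      exact hz ▸ z.2
    by_cases hfin : (range a).Finite
    · obtain ⟨n, rfl⟩ := hfin.isClosed.mem_of_tendsto hax (Eventually.of_forall mem_range_self)
      exact haS n
    · have himg : Subtype.val '' (Subtype.val ⁻¹' range a : Set S) = range a := by
        rw [image_preimage_eq_iff, Subtype.range_coe]
        rintro _ ⟨n, rfl⟩
        exact haS n
      obtain ⟨y, hy⟩ := hA (Subtype.val ⁻¹' range a) (by
        rintro z ⟨n, hn⟩
        obtain ⟨w, hw, hwz⟩ := haA n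
        rwa [Subtype.ext (hn.symm.trans hwz.symm)]) (fun h => hfin (himg ▸ h.image _))
      have hy' : AccPt (y : Y) (𝓟 (range a)) := by
        have := hy.map continuous_subtype_val.continuousAt Subtype.val_injective
        rwa [map_principal, himg] at this
      exact hy'.eq_of_tendsto hax ▸ y.2
  rw [IsInducing.subtypeVal.isCompact_iff, IsInducing.subtypeVal.closure_eq_preimage_closure_image,
    image_preimage_eq_of_subset (by simpa using hsub)]
  exact hK

/-! ### Functions on almost discrete spaces -/

theorem Continuous.of_eq_or_eq_apply {X Z : Type*} [TopologicalSpace X] [TopologicalSpace Z]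
    {p : X} (hp : ∀ x, x ≠ p → IsOpen ({x} : Set X)) {f g : X → Z} (hf : Continuous f)
    (hg : ∀ x, g x = f x ∨ g x = f p) : Continuous g := by
  rw [continuous_iff_continuousAt]
  intro x
  by_cases hx : x = p
  · subst hx
    intro U hU
    have hgx : g x = f x := by simpa using hg x
    rw [hgx] at hU
    have hU' := hf.continuousAt hU
    rw [mem_map] at hU' ⊢
    filter_upwards [hU'] with z hz
    rcases hg z with h | h
    · exact (congrArg (· ∈ U) h).mpr hz
    · exact (congrArg (· ∈ U) h).mpr (mem_of_mem_nhds hU)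
  · rw [ContinuousAt, (isOpen_singleton_iff_nhds_eq_pure x).1 (hp x hx)]
    exact tendsto_pure_nhds g x

/-- If `C_p(X)` is a hereditary g-space and `p` is the only nonisolated point of `X`, then every
continuous real function on `X` takes the value at `p` outside a countable set. -/
theorem countable_setOf_apply_ne {X : Type*} [TopologicalSpace X] (hX : IsHereditaryGSpace (Cp X))
    {p : X} (hp : ∀ x, x ≠ p → IsOpen ({x} : Set X)) (f : Cp X) :
    {x | f.1 x ≠ f.1 p}.Countable := by
  -- `Φ` maps the Cantor cube into `C_p(X)`. The image `S` of the countable supports is shown to be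
  -- compact, hence closed, which forces `f ∈ S`.
  let Φ : (X → Bool) → Cp X := fun F => ⟨fun x => if F x then f.1 x else f.1 p,
    f.2.of_eq_or_eq_apply hp fun x => by cases F x <;> simp⟩
  have hΦ : Continuous Φ := by
    refine Continuous.subtype_mk (continuous_pi fun x => ?_) _
    exact (continuous_of_discreteTopology (f := fun b : Bool => if b then f.1 x else f.1 p)).comp
      (continuous_apply x)
  let S : Set (Cp X) := Φ '' {F | {x | F x = true}.Countable}
  have hcc : IsCountablyCompactIn (univ : Set S) := by
    intro B _ hB
    let b := hB.natEmbedding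
    choose F hF hFb using fun n => (b n).1.2
    -- Countably many countable supports have a countable union, so the chosen sequence lies in one
    -- compact subcube whose image stays in `S`.
    let K : Set (X → Bool) := {G | ∀ x, x ∉ ⋃ n, {x | F n x = true} → G x = false}
    have hK : IsCompact K := by
      refine IsClosed.isCompact ?_
      simp only [K, ofPred_forall]
      exact isClosed_iInter fun x => isClosed_iInter fun _ =>
        isClosed_eq (continuous_apply x) continuous_const
    have hKS : Φ '' K ⊆ S := by
      refine image_mono fun G hG => (countable_iUnion hF).mono fun x hx => ?_
      by_contra h
      have h1 : G x = true := hx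
      simp [hG x h] at h1
    have hK' : IsCompact (Subtype.val ⁻¹' (Φ '' K) : Set S) := by
      rw [IsInducing.subtypeVal.isCompact_iff, image_preimage_eq_of_subset (by simpa using hKS)]
      exact hK.image hΦ
    have hinf : (range fun n => (b n : S)).Infinite :=
      infinite_range_of_injective (Subtype.val_injective.comp b.injective)
    obtain ⟨y, -, hy⟩ := hinf.exists_accPt_of_subset_isCompact hK' (by
      rintro _ ⟨n, rfl⟩
      refine ⟨F n, fun x hx => ?_, hFb n⟩
      by_contra h
      exact hx (mem_iUnion.2 ⟨n, by simpa using h⟩))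
    refine ⟨y, hy.mono (principal_mono.2 ?_)⟩
    rintro _ ⟨n, rfl⟩
    exact (b n).2
  have hS : IsCompact S := by
    have := hX S univ hcc
    rwa [closure_univ, ← isCompact_iff_isCompact_univ] at this
  have hlim : Tendsto (fun s : Finset X => Φ fun x => by classical exact decide (x ∈ s)) atTop
      (𝓝 (Φ fun _ => true)) := by
    refine (hΦ.tendsto _).comp (tendsto_pi_nhds.2 fun x => tendsto_const_nhds.congr' ?_)
    filter_upwards [eventually_ge_atTop {x}] with s hs
    simpa using hs
  obtain ⟨F, hF, hFf⟩ := hS.isClosed.mem_of_tendsto hlim (Eventually.of_forall fun s =>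
    ⟨_, (s.finite_toSet.subset fun x hx => by simpa using hx).countable, rfl⟩)
  refine hF.mono fun x hx => ?_
  by_contra h
  have h1 := congrFun (congrArg Subtype.val hFf) x
  have h2 : F x = false := by simpa using h
  simp only [Φ, h2] at h1
  exact hx (by simpa using h1.symm)

/-! ### The Fréchet–Urysohn property of `C_p` -/

/-- Closing off in `ℕ` many stages suffices: a countable set has countably many finite subsets, and
a finite subset of the increasing union lies in one stage. -/
theorem exists_countable_saturated {Y : Type*} {s : Finset Y → Set Y} (hs : ∀ T, (s T).Countable)
    {M : Set Y} (hM : M.Countable) :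
    ∃ N, M ⊆ N ∧ N.Countable ∧ ∀ T : Finset Y, (T : Set Y) ⊆ N → s T ⊆ N := by
  let N : ℕ → Set Y := fun n =>
    Nat.rec M (fun _ L => L ∪ ⋃ T ∈ {T : Finset Y | (T : Set Y) ⊆ L}, s T) n
  have hsucc : ∀ n, N (n + 1) = N n ∪ ⋃ T ∈ {T : Finset Y | (T : Set Y) ⊆ N n}, s T :=
    fun _ => rfl
  have hmono : Monotone N := monotone_nat_of_le_succ fun n => by
    rw [hsucc]; exact subset_union_left
  have hcount : ∀ n, (N n).Countable := by
    intro n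
    induction n with
    | zero => exact hM
    | succ n ih =>
      rw [hsucc]
      refine ih.union (Countable.biUnion ?_ fun T _ => hs T)
      have hfin := (countable_ofPred_finite_subset ih).preimage_of_injOn
        (f := fun T : Finset Y => (T : Set Y)) Finset.coe_injective.injOn
      refine hfin.mono fun T hT => ?_
      exact ⟨T.finite_toSet, hT⟩
  refine ⟨⋃ n, N n, subset_iUnion N 0, countable_iUnion hcount, fun T hT => ?_⟩
  obtain ⟨n, hn⟩ := Directed.exists_mem_subset_of_finset_subset_biUnion
    (f := N) hmono.directed_le hT
  refine subset_trans ?_ (subset_iUnion N (n + 1))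
  rw [hsucc]
  exact subset_union_of_subset_right (subset_biUnion_of_mem (u := s) hn) _

/-- `C_p(Y)` is Fréchet–Urysohn if every continuous function on `Y` factors, up to a countable
set, through a fixed self-map with countable range. -/
theorem frechetUrysohnSpace_Cp {Y : Type*} [TopologicalSpace Y] {r : Y → Y}
    (hr : (range r).Countable) (h : ∀ g : Cp Y, {y | g.1 y ≠ g.1 (r y)}.Countable) :
    FrechetUrysohnSpace (Cp Y) := by
  refine ⟨fun A f hf => ?_⟩
  have happrox : ∀ (T : Finset Y) (n : ℕ), ∃ a ∈ A, ∀ y ∈ T,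
      dist (a.1 y) (f.1 y) < 1 / ((n : ℝ) + 1) := by
    intro T n
    have hU : {a : Cp Y | ∀ y ∈ T, dist (a.1 y) (f.1 y) < 1 / ((n : ℝ) + 1)} ∈ 𝓝 f := by
      refine (eventually_all_finset T).2 fun y _ => ?_
      have hc : Continuous fun a : Cp Y => a.1 y :=
        (continuous_apply y).comp continuous_subtype_val
      exact hc.continuousAt (Metric.ball_mem_nhds _ Nat.one_div_pos_of_nat)
    obtain ⟨a, ha, haA⟩ := mem_closure_iff_nhds.1 hf _ hU
    exact ⟨a, haA, ha⟩
  choose a haA ha using happrox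
  -- `N` absorbs the exceptional sets of `f` and of every approximant `a T n` with `T ⊆ N`.
  -- Convergence on `N` then gives convergence at `y ∉ N`, where all these functions agree with
  -- their values at `r y ∈ N`.
  obtain ⟨N, hMN, hN, hsat⟩ := exists_countable_saturated
    (s := fun T => ⋃ n, {y | (a T n).1 y ≠ (a T n).1 (r y)})
    (fun T => countable_iUnion fun n => h _) (hr.union (h f))
  rcases isEmpty_or_nonempty Y with hY | ⟨⟨y₀⟩⟩
  · refine ⟨fun _ => a ∅ 0, fun _ => haA _ _, ?_⟩
    rw [Subsingleton.elim f (a ∅ 0)]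
    exact tendsto_const_nhds
  obtain ⟨e, he⟩ := hN.exists_eq_range ⟨r y₀, hMN (Or.inl ⟨y₀, rfl⟩)⟩
  classical
  let T : ℕ → Finset Y := fun n => (Finset.range (n + 1)).image e
  have hTN : ∀ n, (T n : Set Y) ⊆ N := by
    intro n y hy
    obtain ⟨m, -, rfl⟩ := Finset.mem_image.1 hy
    exact he ▸ mem_range_self m
  have hlimN : ∀ y ∈ N, Tendsto (fun n => (a (T n) n).1 y) atTop (𝓝 (f.1 y)) := by
    intro y hy
    rw [he] at hy
    obtain ⟨m, rfl⟩ := hy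
    rw [tendsto_iff_dist_tendsto_zero]
    refine squeeze_zero' (Eventually.of_forall fun _ => dist_nonneg) ?_
      tendsto_one_div_add_atTop_nhds_zero_nat
    filter_upwards [eventually_ge_atTop m] with n hn
    exact (ha (T n) n _ (Finset.mem_image.2 ⟨m, Finset.mem_range.2 (by omega), rfl⟩)).le
  refine ⟨fun n => a (T n) n, fun n => haA _ _, ?_⟩
  rw [tendsto_subtype_rng, tendsto_pi_nhds]
  intro y
  by_cases hy : y ∈ N
  · exact hlimN y hy
  · have hfy : f.1 y = f.1 (r y) := by
      by_contra hne
      exact hy (hMN (Or.inr hne))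
    rw [hfy]
    refine (hlimN (r y) (hMN (Or.inl ⟨y, rfl⟩))).congr fun n => ?_
    by_contra hne
    exact hy (hsat (T n) (hTN n) (mem_iUnion.2 ⟨n, Ne.symm hne⟩))

/-! ### Topological sums -/

theorem isGSpace_Cp_sigma {ι : Type*} {X : ι → Type*} [∀ i, TopologicalSpace (X i)]
    (h : ∀ i, IsGSpace (Cp (X i))) : IsGSpace (Cp (Σ i, X i)) := by
  intro A hA
  let ρ : ∀ i, Cp (Σ i, X i) → Cp (X i) := fun i g =>
    ⟨fun x => g.1 ⟨i, x⟩, g.2.comp continuous_sigmaMk⟩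
  have hρ : ∀ i, Continuous (ρ i) := by
    refine fun i => Continuous.subtype_mk (continuous_pi fun x => ?_) _
    exact (continuous_apply (⟨i, x⟩ : Σ i, X i)).comp continuous_subtype_val
  let Ψ : (∀ i, Cp (X i)) → Cp (Σ i, X i) := fun g =>
    ⟨fun z => (g z.1).1 z.2, continuous_sigma fun i => (g i).2⟩
  have hΨ : Continuous Ψ := Continuous.subtype_mk (continuous_pi fun z =>
    (continuous_apply z.2).comp (continuous_subtype_val.comp (continuous_apply z.1))) _
  have hK := (isCompact_univ_pi fun i => h i _ (hA.image (hρ i))).image hΨ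
  refine hK.of_isClosed_subset isClosed_closure (closure_minimal ?_ hK.isClosed)
  exact fun g hg => ⟨fun i => ρ i g, fun i _ => subset_closure ⟨g, hg, rfl⟩, rfl⟩

theorem CompletelyRegularSpace.sigma {ι : Type*} {X : ι → Type*} [∀ i, TopologicalSpace (X i)]
    [∀ i, CompletelyRegularSpace (X i)] : CompletelyRegularSpace (Σ i, X i) := by
  refine ⟨?_⟩
  rintro ⟨i, x⟩ K hK hx
  obtain ⟨f, hf, hfx, hfK⟩ := CompletelyRegularSpace.completely_regular x (Sigma.mk i ⁻¹' K)
    (hK.preimage continuous_sigmaMk) hx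
  classical
  refine ⟨fun z => if hz : z.1 = i then f (hz ▸ z.2) else 1, continuous_sigma fun j => ?_,
    by simpa using hfx, ?_⟩
  · by_cases hj : j = i
    · subst hj
      simpa using hf
    · simpa [hj] using continuous_const
  · rintro ⟨j, y⟩ hy
    by_cases hj : j = i
    · subst hj
      simpa using hfK hy
    · simp [hj]

theorem mainTheorem5 {ι : Type*} [Countable ι] (X : ι → Type*)
    [∀ i, TopologicalSpace (X i)]
    (hX : ∀ i, IsAlmostDiscrete (X i)) (hG : ∀ i, IsGrothendieckSpace (X i)) :
    IsGrothendieckSpace (Σ i, X i) := by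
  have hT (i : ι) : T35Space (X i) := (hG i).1
  have hCR : CompletelyRegularSpace (Σ i, X i) := CompletelyRegularSpace.sigma
  refine ⟨{}, ?_⟩
  choose p _ hp using hX
  have hiso : ∀ i x, x ≠ p i → IsOpen ({x} : Set (X i)) := fun i x hx => by
    by_contra h
    exact hx (hp i x h)
  have hFU : FrechetUrysohnSpace (Cp (Σ i, X i)) := by
    refine frechetUrysohnSpace_Cp (r := fun z => ⟨z.1, p z.1⟩) ?_ fun g => ?_
    · refine (countable_range fun i => (⟨i, p i⟩ : Σ i, X i)).mono ?_
      rintro _ ⟨z, rfl⟩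
      exact ⟨z.1, rfl⟩
    · refine (countable_iUnion fun i => (countable_setOf_apply_ne (hG i).2 (hiso i)
        ⟨fun x => g.1 ⟨i, x⟩, g.2.comp continuous_sigmaMk⟩).image (Sigma.mk i)).mono ?_
      rintro ⟨i, x⟩ hx
      exact mem_iUnion.2 ⟨i, x, hx, rfl⟩
  refine IsHereditaryGSpace.of_frechetUrysohn (isGSpace_Cp_sigma fun i A hA => ?_)
  -- Heredity is applied to the subspace `univ` and transported back to the whole space.
  have e := Homeomorph.Set.univ (Cp (X i))
  have hA' := (hG i).2 univ _ (hA.image e.symm.continuous)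
  rw [← e.symm.image_closure] at hA'
  exact e.symm.isCompact_image.1 hA'
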